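/- Let $X$ be a topological space and let $U,V\subset X$ be path-connected open subsets with $X=U\cup V$ such that the intersection $U\cap V$ has exactly two path components $A$ and $B$, where $B$ is open in $X$ (as is automatic when $X$ is locally path-connected). Let $a\in A$, $b\in B$. Let $C$ be the quotient space of the disjoint union $U'\sqcup V$, where $U'$ is a copy of $U$, by the identification of every point of $B\subset V$ with the corresponding point of the copy $B'\subset U'$ of $B$; write $b\in C$ also for the image of $b$, and let $\sigma\colon C\to X$ be the map given by the inclusion on $V$ and by the tautological map $U'\to U\subset X$ on $U'$. Write $r\cdot s$ for the path that runs first along $r$ and then along $s$, let products in fundamental groups be induced by it, and for a path $r$ from $x$ to $y$ in a space $Z$ let $\pi(r)\colon\pi_1(Z,y)\to\pi_1(Z,x)$ be the isomorphism $[s]\mapsto[r\cdot s\cdot r^{-1}]$. Let $p$ be a path from $b$ to $a$ in $U$ and $q$ a path from $b$ to $a$ in $V$; let $p'$ be the copy of $p$ in $U'$, and regard $p'$ and $q$ also as paths in $C$. Let $i\colon A\to C$ be the inclusion through $V$ and $\widehat{\imath}\colon A\to C$ the composition of the tautological homeomorphism of $A$ with its copy $A'\subset U'$ and the inclusion $A'\to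 C$. Put \[ \theta=\pi(q)\circ i_*\,,\qquad \widehat{\theta}=\pi(p')\circ\widehat{\imath}_*\ \colon\ \pi_1(A,a)\longrightarrow\pi_1(C,b), \] and let $\tau\in\pi_1(X,b)$ be the class of the loop $p\cdot q^{-1}$. Let $F$ be the free group with one generator $t$. Then $\pi_1(X,b)$ is isomorphic to the quotient of the free product $\pi_1(C,b)*F$ by the relations \[ \widehat{\theta}(\alpha)=t\,\theta(\alpha)\,t^{-1}\qquad\text{for all }\alpha\in\pi_1(A,a), \] by an isomorphism for which the corresponding homomorphism $\pi_1(C,b)*F\to\pi_1(X,b)$ is equal to $\sigma_*$ on $\pi_1(C,b)$ and maps $t$ to $\tau$. -/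

import Mathlib

namespace VanKampen

open MulOpposite

universe u v

noncomputable section

/-- The fundamental group `π₁(X, x)` in the convention in which the product `[γ] * [δ]` is the class
of the path that runs first along `γ` and then along `δ` (see `ofLoop_mul`). Mathlib's
`FundamentalGroup` multiplies in the opposite order, whence the opposite group. -/
abbrev PiOne (X : Type u) [TopologicalSpace X] (x : X) : Type u :=
  (FundamentalGroup X x)ᵐᵒᵖ

namespace PiOne

variable {X : Type u} [TopologicalSpace X] {Y : Type v} [TopologicalSpace Y]

/-- The homotopy class of a loop. -/
def ofLoop {x : X} (γ : Path x x) : PiOne X x :=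
  op (FundamentalGroup.fromPath (Path.Homotopic.Quotient.mk γ))

/-- The homomorphism induced by a continuous map `f` with `f x = y`. -/
def map (f : C(X, Y)) {x : X} {y : Y} (h : f x = y) : PiOne X x →* PiOne Y y :=
  MonoidHom.op (FundamentalGroup.mapOfEq f h)

/-- Change of the base point along a path `p` from `b` to `a`: the map `[r] ↦ [p · r · p⁻¹]`
(see `changeBase_ofLoop`). -/
def changeBase {b a : X} (p : Path b a) : PiOne X a →* PiOne X b :=
  MonoidHom.op (FundamentalGroup.fundamentalGroupMulEquivOfPath p.symm).toMonoidHom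

theorem ofLoop_mul {x : X} (γ δ : Path x x) : ofLoop γ * ofLoop δ = ofLoop (γ.trans δ) := rfl

theorem map_ofLoop (f : C(X, Y)) {x : X} {y : Y} (h : f x = y) (γ : Path x x) :
    map f h (ofLoop γ) = ofLoop ((γ.map f.continuous).cast h.symm h.symm) := by
  subst h
  exact congrArg op (FundamentalGroup.mapOfEq_apply f rfl _)

theorem changeBase_ofLoop {b a : X} (p : Path b a) (r : Path a a) :
    changeBase p (ofLoop r) = ofLoop (p.trans (r.trans p.symm)) := by
  have h : changeBase p (ofLoop r) = ofLoop (p.symm.symm.trans (r.trans p.symm)) := rfl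
  rwa [Path.symm_symm] at h

end PiOne

theorem left_subset_U {X : Type u} {U V A B : Set X} (hUV : U ∩ V = A ∪ B) : A ⊆ U :=
  fun _ hx => (hUV.symm.subset (Or.inl hx)).1

theorem left_subset_V {X : Type u} {U V A B : Set X} (hUV : U ∩ V = A ∪ B) : A ⊆ V :=
  fun _ hx => (hUV.symm.subset (Or.inl hx)).2

theorem right_subset_U {X : Type u} {U V A B : Set X} (hUV : U ∩ V = A ∪ B) : B ⊆ U :=
  fun _ hx => (hUV.symm.subset (Or.inr hx)).1

theorem right_subset_V {X : Type u} {U V A B : Set X} (hUV : U ∩ V = A ∪ B) : B ⊆ V :=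
  fun _ hx => (hUV.symm.subset (Or.inr hx)).2

variable {X : Type u} [TopologicalSpace X]

/-- The underlying point in `X` of a point of the disjoint union of `U` and `V`. -/
def underlying (U V : Set X) : U ⊕ V → X := Sum.elim Subtype.val Subtype.val

/-- Two points of the disjoint union of (a copy of) `U` and `V` are identified when they are equal
or when they have the same underlying point and this point lies in `B`. -/
def glueSetoid (U V B : Set X) : Setoid (U ⊕ V) where
  r s t := s = t ∨ (underlying U V s = underlying U V t ∧ underlying U V s ∈ B)
  iseqv :=
    { refl := fun _ => Or.inl rfl
      symm := by
        rintro s t (h | ⟨h, hB⟩)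
        · exact Or.inl h.symm
        · exact Or.inr ⟨h.symm, h ▸ hB⟩
      trans := by
        rintro s t r (rfl | ⟨h, hB⟩) (rfl | ⟨h', hB'⟩)
        · exact Or.inl rfl
        · exact Or.inr ⟨h', hB'⟩
        · exact Or.inr ⟨h, hB⟩
        · exact Or.inr ⟨h.trans h', hB⟩ }

/-- The space `C`: the disjoint union of a copy `U'` of `U` and of `V`, with the copy `B'` of `B`
in `U'` identified with `B` in `V`, with the quotient topology. -/
def Glue (U V B : Set X) : Type u := Quotient (glueSetoid U V B)

instance (U V B : Set X) : TopologicalSpace (Glue U V B) :=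
  inferInstanceAs (TopologicalSpace (Quotient (glueSetoid U V B)))

/-- The canonical map of `U`, identified with its copy `U'`, to `C`. -/
def inU (U V B : Set X) : C(U, Glue U V B) where
  toFun x := Quotient.mk (glueSetoid U V B) (Sum.inl x)
  continuous_toFun := continuous_quotient_mk'.comp continuous_inl

/-- The canonical map of `V` to `C`. -/
def inV (U V B : Set X) : C(V, Glue U V B) where
  toFun x := Quotient.mk (glueSetoid U V B) (Sum.inr x)
  continuous_toFun := continuous_quotient_mk'.comp continuous_inr

/-- The map `σ : C → X` that is the inclusion on `V` and the tautological map on `U'`. -/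
def sigma (U V B : Set X) : C(Glue U V B, X) where
  toFun := Quotient.lift (underlying U V) (by
    rintro s t (rfl | ⟨h, -⟩)
    · rfl
    · exact h)
  continuous_toFun := Continuous.quotient_lift
    (continuous_subtype_val.sumElim continuous_subtype_val) _

theorem inU_eq_inV {U V B : Set X} {x : X} (hU : x ∈ U) (hV : x ∈ V) (hB : x ∈ B) :
    inU U V B ⟨x, hU⟩ = inV U V B ⟨x, hV⟩ :=
  Quotient.sound (Or.inr ⟨rfl, hB⟩)

/-- The homomorphism `θ = π(q) ∘ i_* : π₁(A, a) → π₁(C, b)`, where `i : A → C` is the inclusion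
through `V` and `q` is a path in `V` from `b` to `a`. -/
def theta {U V A B : Set X} (hUV : U ∩ V = A ∪ B) {a b : X} (ha : a ∈ A) (hb : b ∈ B)
    (q : Path (⟨b, right_subset_V hUV hb⟩ : V) ⟨a, left_subset_V hUV ha⟩) :
    PiOne A ⟨a, ha⟩ →* PiOne (Glue U V B) (inV U V B ⟨b, right_subset_V hUV hb⟩) :=
  (PiOne.changeBase (q.map (inV U V B).continuous)).comp
    (PiOne.map ((inV U V B).comp (ContinuousMap.inclusion (left_subset_V hUV))) rfl)

/-- The homomorphism `θ̂ = π(p') ∘ î_* : π₁(A, a) → π₁(C, b)`, where `î : A → C` is the map through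
the copy `U'` of `U` and `p'` is the copy in `U'` of a path `p` in `U` from `b` to `a`. -/
def thetaHat {U V A B : Set X} (hUV : U ∩ V = A ∪ B) {a b : X} (ha : a ∈ A) (hb : b ∈ B)
    (p : Path (⟨b, right_subset_U hUV hb⟩ : U) ⟨a, left_subset_U hUV ha⟩) :
    PiOne A ⟨a, ha⟩ →* PiOne (Glue U V B) (inV U V B ⟨b, right_subset_V hUV hb⟩) :=
  (PiOne.changeBase ((p.map (inU U V B).continuous).cast
      (inU_eq_inV (right_subset_U hUV hb) (right_subset_V hUV hb) hb).symm rfl)).comp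
    (PiOne.map ((inU U V B).comp (ContinuousMap.inclusion (left_subset_U hUV))) rfl)

/-- The class `τ ∈ π₁(X, b)` of the loop `p · q⁻¹`. -/
def tau {U V A B : Set X} (hUV : U ∩ V = A ∪ B) {a b : X} (ha : a ∈ A) (hb : b ∈ B)
    (p : Path (⟨b, right_subset_U hUV hb⟩ : U) ⟨a, left_subset_U hUV ha⟩)
    (q : Path (⟨b, right_subset_V hUV hb⟩ : V) ⟨a, left_subset_V hUV ha⟩) : PiOne X b :=
  PiOne.ofLoop (Path.trans (x := b) (y := a) (z := b)
    (p.map continuous_subtype_val) (q.map continuous_subtype_val).symm)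

/-- The free group `F` with one generator. -/
abbrev F : Type := FreeGroup Unit

/-- The generator `t` of `F`. -/
def t : F := FreeGroup.of ()

/-- For homomorphisms `θ, θ̂ : K → H`, the elements `θ̂(α) (t θ(α) t⁻¹)⁻¹` of `H * F`. -/
def relators {K : Type u} {H : Type v} [Group K] [Group H] (θ θhat : K →* H) :
    Set (Monoid.Coprod H F) :=
  Set.range fun α : K => Monoid.Coprod.inl (θhat α) *
    (Monoid.Coprod.inr t * Monoid.Coprod.inl (θ α) * (Monoid.Coprod.inr t)⁻¹)⁻¹

/-- The group `(H * F) / ⟨θ̂(α) = t θ(α) t⁻¹ for all α⟩`. -/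
abbrev FreeProductWithRelation {K : Type u} {H : Type v} [Group K] [Group H] (θ θhat : K →* H) :
    Type v :=
  Monoid.Coprod H F ⧸ Subgroup.normalClosure (relators θ θhat)

end

end VanKampen

/-!
A homomorphism from a fundamental group of a path-connected space to a group `H` is, up to gauge
transformations, the same as a transport: a functor from the fundamental groupoid to `H`, given by
its values on curves. Transports are local in nature: a function that is defined on the small curves
of an open cover and commutes around small squares integrates to a unique transport, which is the
groupoid form of van Kampen's theorem.

Along `σ`, the space `X` arises from `C` by identifying the two copies of `A`. So the transports on
`X` are the transports on `C` that agree on the two copies of `A`. Given `f : π₁(C, b) → H`, an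
element `T` with `f (θ̂ α) = T * f (θ α) * T⁻¹` is exactly what is needed to make a transport with
holonomy `f` agree on the two copies by a gauge transformation that is supported on one of them, and
`T` becomes the value at `τ`. Hence `π₁(X, b)` has the universal property of the quotient.
-/

namespace VanKampen

open Topology Filter unitInterval MulOpposite

section Curves

/-- The linear path from `s` to `t` in the unit interval. -/
def seg (s t : I) : C(I, I) := ⟨Set.Icc.convexComb s t, Set.Icc.continuous_convexComb s t⟩

@[simp]
theorem seg_zero (s t : I) : seg s t 0 = s := Set.Icc.convexComb_zero s t

@[simp]
theorem seg_one (s t : I) : seg s t 1 = t := Set.Icc.convexComb_one s t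

@[simp]
theorem seg_self_apply (s x : I) : seg s s x = s := Set.Icc.convexComb_eq s x

theorem seg_zero_one : seg 0 1 = ContinuousMap.id I :=
  ContinuousMap.ext Set.Icc.convexComb_zero_one

theorem seg_mem {J : Set I} [hJ : J.OrdConnected] {s t : I} (hs : s ∈ J) (ht : t ∈ J) (x : I) :
    seg s t x ∈ J := by
  rcases le_total s t with h | h
  · exact hJ.out hs ht ⟨Set.Icc.le_convexComb h x, Set.Icc.convexComb_le h x⟩
  · rw [show seg s t x = seg t s (σ x) from (Set.Icc.convexComb_symm t s x).symm]
    exact hJ.out ht hs ⟨Set.Icc.le_convexComb h _, Set.Icc.convexComb_le h _⟩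

@[fun_prop]
theorem continuous_seg_uncurry {Z : Type*} [TopologicalSpace Z] {f g h : Z → I}
    (hf : Continuous f) (hg : Continuous g) (hh : Continuous h) :
    Continuous fun z => seg (f z) (g z) (h z) :=
  Set.Icc.continuous_convexComb_prod.comp (hf.prodMk (hg.prodMk hh))

variable {X : Type*} [TopologicalSpace X]

/-- The horizontal slice at height `t` of a square. -/
def row (S : C(I × I, X)) (t : I) : C(I, X) := S.comp ⟨fun x => (x, t), by fun_prop⟩

/-- The vertical slice at abscissa `s` of a square. -/
def col (S : C(I × I, X)) (s : I) : C(I, X) := S.comp ⟨fun y => (s, y), by fun_prop⟩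

/-- A curve, regarded as a path between its end points. -/
def toPath (c : C(I, X)) : Path (c 0) (c 1) := ⟨c, rfl, rfl⟩

theorem trans_comp_seg_zero_half {x y z : X} (γ : Path x y) (δ : Path y z) {m : I}
    (hm : (m : ℝ) = 1 / 2) : (γ.trans δ).toContinuousMap.comp (seg 0 m) = γ.toContinuousMap := by
  ext u
  have hu : (seg 0 m u : ℝ) = u / 2 := by simp [seg, Set.Icc.coe_convexComb, hm, div_eq_mul_inv]
  change (γ.trans δ) (seg 0 m u) = γ u
  rw [← γ.extend_apply, ← (γ.trans δ).extend_apply, Path.extend_trans_of_le_half, hu]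
  · congr 1; ring
  · linarith [u.2.2]

theorem trans_comp_seg_half_one {x y z : X} (γ : Path x y) (δ : Path y z) {m : I}
    (hm : (m : ℝ) = 1 / 2) : (γ.trans δ).toContinuousMap.comp (seg m 1) = δ.toContinuousMap := by
  ext u
  have hu : (seg m 1 u : ℝ) = (1 + u) / 2 := by simp [seg, Set.Icc.coe_convexComb, hm]; ring
  change (γ.trans δ) (seg m 1 u) = δ u
  rw [← δ.extend_apply, ← (γ.trans δ).extend_apply, Path.extend_trans_of_half_le, hu]
  · congr 1; ring
  · linarith [u.2.1]

theorem PiOne.exists_ofLoop {x : X} (g : PiOne X x) : ∃ γ : Path x x, PiOne.ofLoop γ = g := by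
  obtain ⟨g⟩ := g
  induction g using Quotient.inductionOn
  exact ⟨_, rfl⟩

theorem exists_comp_eq_of_isEmbedding {Y Z : Type*} [TopologicalSpace Y] [TopologicalSpace Z]
    {f : C(Y, X)} (hf : IsEmbedding f) (c : C(Z, X)) (hc : ∀ z, c z ∈ Set.range f) :
    ∃ c' : C(Z, Y), f.comp c' = c := by
  choose g hg using hc
  exact ⟨⟨g, hf.continuous_iff.2 ((funext hg : f ∘ g = c) ▸ c.continuous)⟩, ContinuousMap.ext hg⟩

end Curves

section LocalTransport

variable {X : Type*} [TopologicalSpace X] {H : Type*} [Group H]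

/-- `φ` is, as far as the members of `𝒲` are concerned, the value on curves of a functor from the
fundamental groupoid to the group `H`: it is trivial on constant curves and commutes around every
square that lies in a member of `𝒲`. Degenerate squares yield the compatibility with concatenation
and with homotopies. -/
structure IsTransportOn (𝒲 : Set (Set X)) (φ : C(I, X) → H) : Prop where
  const : ∀ x, φ (ContinuousMap.const I x) = 1
  square : ∀ S : C(I × I, X), (∃ W ∈ 𝒲, ∀ z, S z ∈ W) →
    φ (row S 0) * φ (col S 1) = φ (col S 0) * φ (row S 1)

/-- `f` is a primitive of `φ` along the restriction of the curve `c` to `J`: nearby values of `f`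
differ by the value of `φ` on the piece of `c` in between. -/
def IsPrimitiveOn (φ : C(I, X) → H) (c : C(I, X)) (J : Set I) (f : I → H) : Prop :=
  ∀ s ∈ J, ∀ᶠ t in 𝓝[J] s, f t = f s * φ (c.comp (seg s t))

/-- `f` is a primitive of `φ` along the whole curve `c`. -/
def IsPrimitive (φ : C(I, X) → H) (c : C(I, X)) (f : I → H) : Prop :=
  ∀ s, ∀ᶠ t in 𝓝 s, f t = f s * φ (c.comp (seg s t))

theorem isPrimitiveOn_univ {φ : C(I, X) → H} {c : C(I, X)} {f : I → H} :
    IsPrimitiveOn φ c Set.univ f ↔ IsPrimitive φ c f := by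
  simp only [IsPrimitiveOn, IsPrimitive, Set.mem_univ, nhdsWithin_univ, forall_const]

theorem IsPrimitive.const_mul {φ : C(I, X) → H} {c : C(I, X)} {f : I → H}
    (hf : IsPrimitive φ c f) (h : H) : IsPrimitive φ c fun s => h * f s := fun s =>
  (hf s).mono fun _ ht => (congrArg (h * ·) ht).trans (mul_assoc _ _ _).symm

theorem IsPrimitive.ext {φ : C(I, X) → H} {c : C(I, X)} {f g : I → H} (hf : IsPrimitive φ c f)
    (hg : IsPrimitive φ c g) (h0 : f 0 = g 0) : f = g := by
  have hconst : IsLocallyConstant fun s => f s * (g s)⁻¹ := by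
    rw [IsLocallyConstant.iff_eventually_eq]
    intro s
    filter_upwards [hf s, hg s] with t hft hgt
    rw [hft, hgt]
    group
  funext s
  rw [← mul_inv_eq_one, hconst.apply_eq_of_preconnectedSpace s 0, h0, mul_inv_cancel]

theorem exists_eventually_seg_subset {𝒲 : Set (Set X)} (hopen : ∀ W ∈ 𝒲, IsOpen W)
    (hcov : ⋃₀ 𝒲 = Set.univ) (c : C(I, X)) (s : I) :
    ∃ W ∈ 𝒲, ∀ᶠ t in 𝓝 s, ∀ x, c (seg s t x) ∈ W := by
  obtain ⟨W, hW, hs⟩ := Set.mem_sUnion.1 (hcov.symm.subset (Set.mem_univ (c s)))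
  obtain ⟨l, r, hsJ, hJ, hJW⟩ := exists_Icc_mem_subset_of_mem_nhds
    (((hopen W hW).preimage c.continuous).mem_nhds hs)
  refine ⟨W, hW, ?_⟩
  filter_upwards [hJ] with t ht x using hJW (seg_mem hsJ ht x)

theorem eventually_forall_exists_rectangle_subset {𝒲 : Set (Set X)} (hopen : ∀ W ∈ 𝒲, IsOpen W)
    (hcov : ⋃₀ 𝒲 = Set.univ) (S : C(I × I, X)) (y : I) :
    ∀ᶠ y' in 𝓝 y, ∀ x, ∃ W ∈ 𝒲, ∀ᶠ x' in 𝓝 x,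
      ∀ z : I × I, S (seg x x' z.1, seg y y' z.2) ∈ W := by
  suffices ∀ᶠ y' in 𝓝 y, ∀ x ∈ (Set.univ : Set I), ∃ W ∈ 𝒲, ∀ᶠ x' in 𝓝 x,
      ∀ z : I × I, S (seg x x' z.1, seg y y' z.2) ∈ W from this.mono fun y' h x => h x trivial
  refine isCompact_univ.eventually_forall_of_forall_eventually fun x _ => ?_
  obtain ⟨W, hW, hxy⟩ := Set.mem_sUnion.1 (hcov.symm.subset (Set.mem_univ (S (x, y))))
  obtain ⟨P, hP, Q, hQ, hPQ⟩ := mem_nhds_prod_iff.1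
    (((hopen W hW).preimage S.continuous).mem_nhds hxy)
  obtain ⟨l, r, -, hlr, hlrP⟩ := exists_Icc_mem_subset_of_mem_nhds hP
  obtain ⟨l', r', hy, hlr', hlrQ⟩ := exists_Icc_mem_subset_of_mem_nhds hQ
  rw [nhds_prod_eq]
  refine (Eventually.prod_mk hlr' (eventually_mem_nhds_iff.2 hlr)).mono ?_
  rintro ⟨y', x'⟩ ⟨hy', hx'⟩
  refine ⟨W, hW, ?_⟩
  filter_upwards [hx'] with x'' hx'' z
  exact hPQ ⟨hlrP (seg_mem (mem_of_mem_nhds hx') hx'' _), hlrQ (seg_mem hy hy' _)⟩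

namespace IsTransportOn

variable {𝒲 : Set (Set X)} {φ : C(I, X) → H}

theorem square_of_edges (h : IsTransportOn 𝒲 φ) {W : Set X} (hW : W ∈ 𝒲) (S : C(I × I, X))
    (hS : ∀ z, S z ∈ W) {bottom top left right : C(I, X)} (hbottom : ∀ x, S (x, 0) = bottom x)
    (htop : ∀ x, S (x, 1) = top x) (hleft : ∀ y, S (0, y) = left y)
    (hright : ∀ y, S (1, y) = right y) : φ bottom * φ right = φ left * φ top := by
  rw [← show row S 0 = bottom from ContinuousMap.ext hbottom,
    ← show row S 1 = top from ContinuousMap.ext htop,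
    ← show col S 0 = left from ContinuousMap.ext hleft,
    ← show col S 1 = right from ContinuousMap.ext hright]
  exact h.square S ⟨W, hW, hS⟩

theorem seg_mul_seg (h : IsTransportOn 𝒲 φ) {W : Set X} (hW : W ∈ 𝒲) (c : C(I, X)) {J : Set I}
    [J.OrdConnected] (hJ : ∀ x ∈ J, c x ∈ W) {r s t : I} (hr : r ∈ J) (hs : s ∈ J) (ht : t ∈ J) :
    φ (c.comp (seg r s)) * φ (c.comp (seg s t)) = φ (c.comp (seg r t)) := by
  rw [← one_mul (φ (c.comp (seg r t))), ← h.const (c r)]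
  exact h.square_of_edges hW
    (c.comp ⟨fun z => seg (seg r s z.1) (seg r t z.1) z.2, by fun_prop⟩)
    (fun z => hJ _ (seg_mem (seg_mem hr hs _) (seg_mem hr ht _) _))
    (fun _ => congrArg c (seg_zero _ _)) (fun _ => congrArg c (seg_one _ _))
    (fun _ => congrArg c (by simp)) (fun _ => congrArg c (by simp))

theorem apply_comp_seg_self (h : IsTransportOn 𝒲 φ) (c : C(I, X)) (s : I) :
    φ (c.comp (seg s s)) = 1 := by
  rw [← h.const (c s)]
  exact congrArg φ (ContinuousMap.ext fun x => congrArg c (seg_self_apply s x))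

theorem isPrimitive_of_forall_mem (h : IsTransportOn 𝒲 φ) {W : Set X} (hW : W ∈ 𝒲) {c : C(I, X)}
    (hc : ∀ x, c x ∈ W) : IsPrimitive φ c fun s => φ (c.comp (seg 0 s)) := fun _ =>
  Eventually.of_forall fun _ =>
    (h.seg_mul_seg hW c (J := Set.univ) (fun x _ => hc x) trivial trivial trivial).symm

theorem apply_eq_of_isPrimitive (h : IsTransportOn 𝒲 φ) {W : Set X} (hW : W ∈ 𝒲) {c : C(I, X)}
    (hc : ∀ x, c x ∈ W) {f : I → H} (hf : IsPrimitive φ c f) (hf0 : f 0 = 1) : f 1 = φ c := by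
  have hfφ := congrFun (hf.ext (h.isPrimitive_of_forall_mem hW hc)
    (hf0.trans (h.apply_comp_seg_self c 0).symm)) 1
  rwa [seg_zero_one, ContinuousMap.comp_id] at hfφ

theorem exists_isPrimitiveOn_Iic_extend (h : IsTransportOn 𝒲 φ) {W : Set X} (hW : W ∈ 𝒲)
    {c : C(I, X)} {s t : I} (hc : ∀ x ∈ Set.Icc s t, c x ∈ W) {f : I → H}
    (hf : IsPrimitiveOn φ c (Set.Iic s) f) :
    ∃ g, g 0 = f 0 ∧ IsPrimitiveOn φ c (Set.Iic t) g := by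
  refine ⟨fun r => if r ≤ s then f r else f s * φ (c.comp (seg s r)), if_pos nonneg',
    fun r hrt => ?_⟩
  rcases lt_trichotomy r s with hlt | rfl | hgt
  · have hfr := hf r hlt.le
    rw [nhdsWithin_eq_nhds.2 (Iic_mem_nhds hlt)] at hfr
    filter_upwards [mem_nhdsWithin_of_mem_nhds hfr,
      mem_nhdsWithin_of_mem_nhds (Iio_mem_nhds hlt)] with x hx hxs
    rw [if_pos hlt.le, if_pos (le_of_lt hxs), hx]
  · filter_upwards [mem_nhdsWithin_of_mem_nhds
      (eventually_nhdsWithin_iff.1 (hf r Set.self_mem_Iic))] with x hx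
    rw [if_pos le_rfl]
    split_ifs with hxr
    exacts [hx hxr, rfl]
  · filter_upwards [mem_nhdsWithin_of_mem_nhds (Ioi_mem_nhds hgt), self_mem_nhdsWithin]
      with x hx hxt
    have hst : s ≤ t := hgt.le.trans hrt
    rw [if_neg hgt.not_ge, if_neg (not_le.2 hx), mul_assoc,
      h.seg_mul_seg hW c hc ⟨le_rfl, hst⟩ ⟨hgt.le, hrt⟩ ⟨le_of_lt hx, hxt⟩]

theorem exists_isPrimitive (h : IsTransportOn 𝒲 φ) (hopen : ∀ W ∈ 𝒲, IsOpen W)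
    (hcov : ⋃₀ 𝒲 = Set.univ) (c : C(I, X)) : ∃ f : I → H, f 0 = 1 ∧ IsPrimitive φ c f := by
  obtain ⟨t, ht0, -, ⟨n, hn⟩, htW⟩ := exists_monotone_Icc_subset_open_cover_unitInterval
    (c := fun W : 𝒲 => c ⁻¹' W.1) (fun W => (hopen _ W.2).preimage c.continuous) (by
      rw [← Set.preimage_iUnion, ← Set.sUnion_eq_iUnion, hcov, Set.preimage_univ])
  have hprim : ∀ k, ∃ f : I → H, f 0 = 1 ∧ IsPrimitiveOn φ c (Set.Iic (t k)) f := by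
    intro k
    induction k with
    | zero =>
      refine ⟨1, rfl, fun s hs => ?_⟩
      filter_upwards [self_mem_nhdsWithin] with r hr
      rw [Set.mem_Iic, ht0, le_zero_iff] at hs hr
      rw [hs, hr, h.apply_comp_seg_self, mul_one]
    | succ k ih =>
      obtain ⟨f, hf0, hf⟩ := ih
      obtain ⟨W, hW⟩ := htW k
      obtain ⟨g, hg0, hg⟩ := h.exists_isPrimitiveOn_Iic_extend W.2 hW hf
      exact ⟨g, hg0.trans hf0, hg⟩
  obtain ⟨f, hf0, hf⟩ := hprim n
  have huniv : Set.Iic (t n) = Set.univ :=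
    Set.eq_univ_of_forall fun x => (hn n le_rfl).symm ▸ (le_one' : x ≤ 1)
  exact ⟨f, hf0, isPrimitiveOn_univ.1 (huniv ▸ hf)⟩

theorem eventually_isPrimitive_row (h : IsTransportOn 𝒲 φ) (hopen : ∀ W ∈ 𝒲, IsOpen W)
    (hcov : ⋃₀ 𝒲 = Set.univ) (S : C(I × I, X)) {f : I → H} {y : I}
    (hf : IsPrimitive φ (row S y) f) :
    ∀ᶠ y' in 𝓝 y, IsPrimitive φ (row S y') fun x => f x * φ ((col S x).comp (seg y y')) := by
  filter_upwards [eventually_forall_exists_rectangle_subset hopen hcov S y] with y' hy' x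
  obtain ⟨W, hW, hx⟩ := hy' x
  filter_upwards [hx, hf x] with x' hx' hfx
  have hsquare : φ ((row S y).comp (seg x x')) * φ ((col S x').comp (seg y y')) =
      φ ((col S x).comp (seg y y')) * φ ((row S y').comp (seg x x')) :=
    h.square_of_edges hW (S.comp ⟨fun z => (seg x x' z.1, seg y y' z.2), by fun_prop⟩) hx'
      (fun _ => congrArg S (Prod.ext rfl (seg_zero _ _)))
      (fun _ => congrArg S (Prod.ext rfl (seg_one _ _)))
      (fun _ => congrArg S (Prod.ext (seg_zero _ _) rfl))
      (fun _ => congrArg S (Prod.ext (seg_one _ _) rfl))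
  rw [hfx, mul_assoc, hsquare, mul_assoc]

end IsTransportOn

end LocalTransport

/-- A transport on `X` with values in the group `H`: a functor from the fundamental groupoid of `X`
to the one-object groupoid `H`, encoded by its values on curves. -/
structure Transport (X : Type*) [TopologicalSpace X] (H : Type*) [Group H] where
  toFun : C(I, X) → H
  isTransportOn : IsTransportOn {Set.univ} toFun

namespace Transport

variable {X Y Z : Type*} [TopologicalSpace X] [TopologicalSpace Y] [TopologicalSpace Z]
  {H K : Type*} [Group H] [Group K]

instance : FunLike (Transport X H) C(I, X) H where
  coe := toFun
  coe_injective := by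
    rintro ⟨φ, _⟩ ⟨ψ, _⟩ rfl
    rfl

@[ext]
theorem ext {φ ψ : Transport X H} (h : ∀ c, φ c = ψ c) : φ = ψ := DFunLike.ext φ ψ h

section Operations

/-- The composition of a transport with a homomorphism of groups. -/
def map (g : H →* K) (φ : Transport X H) : Transport X K where
  toFun c := g (φ c)
  isTransportOn :=
    { const x := (congrArg g (φ.isTransportOn.const x)).trans (map_one g)
      square S hS := (map_mul g _ _).symm.trans
        ((congrArg g (φ.isTransportOn.square S hS)).trans (map_mul g _ _)) }

/-- The pullback of a transport along a continuous map. -/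
def comap (f : C(Y, X)) (φ : Transport X H) : Transport Y H where
  toFun c := φ (f.comp c)
  isTransportOn :=
    { const y := φ.isTransportOn.const (f y)
      square S _ := φ.isTransportOn.square (f.comp S) ⟨_, rfl, fun _ => trivial⟩ }

/-- The gauge transform of a transport by a (possibly discontinuous) function `u`, which amounts to
a naturally isomorphic functor on the fundamental groupoid. -/
def gauge (φ : Transport X H) (u : X → H) : Transport X H where
  toFun c := (u (c 0))⁻¹ * φ c * u (c 1)
  isTransportOn :=
    { const x := by
        have hx : φ (ContinuousMap.const I x) = 1 := φ.isTransportOn.const x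
        simp only [hx, ContinuousMap.const_apply, mul_one, inv_mul_cancel]
      square S hS := by
        have hsquare : φ (row S 0) * φ (col S 1) = φ (col S 0) * φ (row S 1) :=
          φ.isTransportOn.square S hS
        change (u (S (0, 0)))⁻¹ * φ (row S 0) * u (S (1, 0)) *
            ((u (S (1, 0)))⁻¹ * φ (col S 1) * u (S (1, 1))) =
          (u (S (0, 0)))⁻¹ * φ (col S 0) * u (S (0, 1)) *
            ((u (S (0, 1)))⁻¹ * φ (row S 1) * u (S (1, 1)))
        simp only [mul_assoc, mul_inv_cancel_left]
        rw [← mul_assoc (φ _) (φ _), hsquare, mul_assoc] }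

theorem gauge_apply (φ : Transport X H) (u : X → H) (c : C(I, X)) :
    φ.gauge u c = (u (c 0))⁻¹ * φ c * u (c 1) := rfl

theorem gauge_one (φ : Transport X H) : φ.gauge 1 = φ := by
  ext c
  simp only [gauge_apply, Pi.one_apply, inv_one, one_mul, mul_one]

theorem comap_gauge (f : C(Y, X)) (φ : Transport X H) (u : X → H) :
    (φ.gauge u).comap f = (φ.comap f).gauge (u ∘ f) := rfl

end Operations

section Homotopy

variable (φ : Transport X H)

theorem apply_const (x : X) : φ (ContinuousMap.const I x) = 1 := φ.isTransportOn.const x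

theorem apply_eq_of_homotopic {x y : X} {γ δ : Path x y} (h : γ.Homotopic δ) :
    φ γ.toContinuousMap = φ δ.toContinuousMap := by
  obtain ⟨F⟩ := h
  have hsquare := φ.isTransportOn.square_of_edges (W := Set.univ) rfl F.toContinuousMap
    (fun _ => trivial) (bottom := ContinuousMap.const I x) (top := ContinuousMap.const I y)
    F.source F.target F.apply_zero F.apply_one
  rw [φ.isTransportOn.const, φ.isTransportOn.const, one_mul, mul_one] at hsquare
  exact hsquare.symm

theorem apply_trans {x y z : X} (γ : Path x y) (δ : Path y z) :
    φ (γ.trans δ).toContinuousMap = φ γ.toContinuousMap * φ δ.toContinuousMap := by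
  have hm : ((⟨1 / 2, by norm_num, by norm_num⟩ : I) : ℝ) = 1 / 2 := rfl
  have hmul := φ.isTransportOn.seg_mul_seg (W := Set.univ) rfl (γ.trans δ).toContinuousMap
    (J := Set.univ) (fun _ _ => trivial) (r := 0) (s := ⟨1 / 2, by norm_num, by norm_num⟩) (t := 1)
    trivial trivial trivial
  rw [trans_comp_seg_zero_half γ δ hm, trans_comp_seg_half_one γ δ hm, seg_zero_one,
    ContinuousMap.comp_id] at hmul
  exact hmul.symm

theorem apply_symm {x y : X} (γ : Path x y) :
    φ γ.symm.toContinuousMap = (φ γ.toContinuousMap)⁻¹ := by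
  rw [eq_inv_iff_mul_eq_one, ← φ.apply_trans,
    φ.apply_eq_of_homotopic (Path.Homotopic.symm_trans γ)]
  exact φ.apply_const y

end Homotopy

section Holonomy

/-- The holonomy of a transport: the homomorphism that it induces on a fundamental group. -/
noncomputable def hol (φ : Transport X H) (x : X) : PiOne X x →* H :=
  MonoidHom.mk'
    (fun g => Quotient.lift (fun γ : Path x x => φ γ.toContinuousMap)
      (fun _ _ h => φ.apply_eq_of_homotopic h) g.unop)
    (by
      rintro ⟨g⟩ ⟨g'⟩
      induction g using Quotient.inductionOn
      induction g' using Quotient.inductionOn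
      exact φ.apply_trans _ _)

theorem hol_ofLoop (φ : Transport X H) {x : X} (γ : Path x x) :
    φ.hol x (PiOne.ofLoop γ) = φ γ.toContinuousMap := rfl

theorem hol_map (g : H →* K) (φ : Transport X H) (x : X) : (φ.map g).hol x = g.comp (φ.hol x) := by
  ext γ
  obtain ⟨γ, rfl⟩ := PiOne.exists_ofLoop γ
  rfl

theorem hol_gauge_apply (φ : Transport X H) (u : X → H) (x : X) (γ : PiOne X x) :
    (φ.gauge u).hol x γ = (u x)⁻¹ * φ.hol x γ * u x := by
  obtain ⟨γ, rfl⟩ := PiOne.exists_ofLoop γ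
  simp only [hol_ofLoop, gauge_apply, Path.coe_toContinuousMap, Path.source, Path.target]

theorem hol_gauge_of_eq_one (φ : Transport X H) {u : X → H} {x : X} (hu : u x = 1) :
    (φ.gauge u).hol x = φ.hol x := by
  ext γ
  rw [hol_gauge_apply, hu, inv_one, one_mul, mul_one]

theorem hol_piOneMap (φ : Transport X H) (f : C(Y, X)) {y : Y} {x : X} (h : f y = x)
    (γ : PiOne Y y) : φ.hol x (PiOne.map f h γ) = (φ.comap f).hol y γ := by
  obtain ⟨γ, rfl⟩ := PiOne.exists_ofLoop γ
  rw [PiOne.map_ofLoop]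
  rfl

theorem hol_changeBase (φ : Transport X H) {b a : X} (p : Path b a) (γ : PiOne X a) :
    φ.hol b (PiOne.changeBase p γ) =
      φ p.toContinuousMap * φ.hol a γ * (φ p.toContinuousMap)⁻¹ := by
  obtain ⟨γ, rfl⟩ := PiOne.exists_ofLoop γ
  rw [PiOne.changeBase_ofLoop, hol_ofLoop, hol_ofLoop, apply_trans, apply_trans, apply_symm,
    mul_assoc]

end Holonomy

section Gauge

variable [PathConnectedSpace X]

theorem exists_eq_gauge {φ ψ : Transport X H} {x : X} {h : H}
    (hhol : ∀ γ, φ.hol x γ = h⁻¹ * ψ.hol x γ * h) : ∃ u : X → H, u x = h ∧ φ = ψ.gauge u := by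
  let d (y : X) : Path x y := PathConnectedSpace.somePath x y
  refine ⟨fun y => (ψ (d y).toContinuousMap)⁻¹ * h * φ (d y).toContinuousMap, ?_, ?_⟩
  · have hx := hhol (PiOne.ofLoop (d x))
    rw [hol_ofLoop, hol_ofLoop] at hx
    simp only [hx]
    group
  · ext c
    have hc := hhol (PiOne.ofLoop ((d (c 0)).trans ((toPath c).trans (d (c 1)).symm)))
    simp only [hol_ofLoop, apply_trans, apply_symm] at hc
    change φ (d (c 0)).toContinuousMap * (φ c * (φ (d (c 1)).toContinuousMap)⁻¹) =
      h⁻¹ * (ψ (d (c 0)).toContinuousMap * (ψ c * (ψ (d (c 1)).toContinuousMap)⁻¹)) * h at hc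
    rw [← mul_assoc, mul_inv_eq_iff_eq_mul, ← eq_inv_mul_iff_mul_eq] at hc
    rw [gauge_apply, hc]
    group

theorem eq_of_gauge_eq_gauge {ψ : Transport X H} {u v : X → H} (huv : ψ.gauge u = ψ.gauge v)
    {x : X} (hx : u x = v x) : u = v := by
  funext y
  let d : Path x y := PathConnectedSpace.somePath x y
  have hd := DFunLike.congr_fun huv d.toContinuousMap
  simpa only [gauge_apply, Path.coe_toContinuousMap, Path.source, Path.target, hx,
    mul_right_inj] using hd

end Gauge

section Realization

open CategoryTheory

/-- The class of the loop that joins the end points of the path `γ` to the base point `x` along a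
frame `d`, that is, a choice of an arrow from `x` to every point. -/
noncomputable def loopOfFrame {x : X}
    (d : ∀ y, FundamentalGroupoid.mk x ⟶ FundamentalGroupoid.mk y) {y z : X} (γ : Path y z) :
    PiOne X x :=
  op (d y ≫ Path.Homotopic.Quotient.mk γ ≫ inv (d z))

section Frame

variable {x : X} (d : ∀ y, FundamentalGroupoid.mk x ⟶ FundamentalGroupoid.mk y)

theorem loopOfFrame_refl (y : X) : loopOfFrame d (Path.refl y) = 1 := by
  change op (d y ≫ 𝟙 _ ≫ inv (d y)) = op (𝟙 _)
  rw [Category.id_comp, IsIso.hom_inv_id]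

theorem loopOfFrame_trans {y z w : X} (γ : Path y z) (δ : Path z w) :
    loopOfFrame d (γ.trans δ) = loopOfFrame d γ * loopOfFrame d δ := by
  change op (d y ≫ (Path.Homotopic.Quotient.mk γ ≫ Path.Homotopic.Quotient.mk δ) ≫ inv (d w)) =
    op ((d y ≫ Path.Homotopic.Quotient.mk γ ≫ inv (d z)) ≫
      (d z ≫ Path.Homotopic.Quotient.mk δ ≫ inv (d w)))
  simp only [Category.assoc, IsIso.inv_hom_id_assoc]

theorem loopOfFrame_eq_of_homotopic {y z : X} {γ δ : Path y z} (h : γ.Homotopic δ) :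
    loopOfFrame d γ = loopOfFrame d δ :=
  congrArg (fun g => op (d y ≫ g ≫ inv (d z))) (Quotient.sound h)

theorem loopOfFrame_square (S : C(I × I, X)) :
    loopOfFrame d (toPath (row S 0)) * loopOfFrame d (toPath (col S 1)) =
      loopOfFrame d (toPath (col S 0)) * loopOfFrame d (toPath (row S 1)) := by
  let bottom : Path ((0, 0) : I × I) (1, 0) := ⟨⟨fun x => (x, 0), by fun_prop⟩, rfl, rfl⟩
  let top : Path ((0, 1) : I × I) (1, 1) := ⟨⟨fun x => (x, 1), by fun_prop⟩, rfl, rfl⟩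
  let left : Path ((0, 0) : I × I) (0, 1) := ⟨⟨fun y => (0, y), by fun_prop⟩, rfl, rfl⟩
  let right : Path ((1, 0) : I × I) (1, 1) := ⟨⟨fun y => (1, y), by fun_prop⟩, rfl, rfl⟩
  have : ContractibleSpace I := (convex_Icc (0 : ℝ) 1).contractibleSpace ⟨0, zero_mem⟩
  have h := (SimplyConnectedSpace.paths_homotopic (bottom.trans right) (left.trans top)).map S
  rw [Path.map_trans, Path.map_trans] at h
  exact (loopOfFrame_trans d _ _).symm.trans
    ((loopOfFrame_eq_of_homotopic d h).trans (loopOfFrame_trans d _ _))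

/-- The transport that sends a curve to the class of its loop with respect to a frame. -/
noncomputable def ofFrame : Transport X (PiOne X x) where
  toFun c := loopOfFrame d (toPath c)
  isTransportOn := ⟨loopOfFrame_refl d, fun S _ => loopOfFrame_square d S⟩

theorem ofFrame_apply {y z : X} (γ : Path y z) :
    ofFrame d γ.toContinuousMap = loopOfFrame d γ := by
  rcases γ with ⟨c, rfl, rfl⟩
  rfl

theorem hol_ofFrame (hd : d x = 𝟙 _) : (ofFrame d).hol x = MonoidHom.id (PiOne X x) := by
  ext γ
  obtain ⟨γ, rfl⟩ := PiOne.exists_ofLoop γ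
  rw [hol_ofLoop, ofFrame_apply]
  simp only [loopOfFrame, hd, IsIso.inv_id, Category.id_comp, Category.comp_id]
  rfl

end Frame

theorem exists_hol_eq [PathConnectedSpace X] {x : X} (f : PiOne X x →* H) :
    ∃ φ : Transport X H, φ.hol x = f := by
  let e (y : X) : FundamentalGroupoid.mk x ⟶ FundamentalGroupoid.mk y :=
    Path.Homotopic.Quotient.mk (PathConnectedSpace.somePath x y)
  refine ⟨(ofFrame fun y => inv (e x) ≫ e y).map f, ?_⟩
  rw [hol_map, hol_ofFrame _ (IsIso.inv_hom_id _), MonoidHom.comp_id]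

end Realization

section Gluing

theorem ext_of_openCover {φ ψ : Transport X H} {𝒲 : Set (Set X)} (hopen : ∀ W ∈ 𝒲, IsOpen W)
    (hcov : ⋃₀ 𝒲 = Set.univ) (h : ∀ c : C(I, X), ∀ W ∈ 𝒲, (∀ x, c x ∈ W) → φ c = ψ c) :
    φ = ψ := by
  ext c
  have hψ : IsPrimitive φ c fun s => ψ (c.comp (seg 0 s)) := fun s => by
    obtain ⟨W, hW, hs⟩ := exists_eventually_seg_subset hopen hcov c s
    filter_upwards [ψ.isTransportOn.isPrimitive_of_forall_mem rfl (c := c) (fun _ => trivial) s, hs]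
      with t ht htW
    exact ht.trans (congrArg _ (h _ W hW htW).symm)
  have hφψ := φ.isTransportOn.apply_eq_of_isPrimitive rfl (fun _ => trivial) hψ
    (ψ.isTransportOn.apply_comp_seg_self c 0)
  rw [seg_zero_one, ContinuousMap.comp_id] at hφψ
  exact hφψ.symm

/-- The value of the extension along a curve is obtained by integrating the local transport. -/
theorem exists_extension {𝒲 : Set (Set X)} {φ : C(I, X) → H} (h : IsTransportOn 𝒲 φ)
    (hopen : ∀ W ∈ 𝒲, IsOpen W) (hcov : ⋃₀ 𝒲 = Set.univ) :
    ∃ ψ : Transport X H, ∀ c : C(I, X), ∀ W ∈ 𝒲, (∀ x, c x ∈ W) → ψ c = φ c := by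
  choose f hf0 hf using h.exists_isPrimitive hopen hcov
  have hsmall (c : C(I, X)) (W) (hW : W ∈ 𝒲) (hc : ∀ x, c x ∈ W) : f c 1 = φ c :=
    h.apply_eq_of_isPrimitive hW hc (hf c) (hf0 c)
  refine ⟨⟨fun c => f c 1, ⟨fun x => ?_, fun S _ => ?_⟩⟩, hsmall⟩
  · obtain ⟨W, hW, hx⟩ := Set.mem_sUnion.1 (hcov.symm.subset (Set.mem_univ x))
    rw [hsmall _ W hW fun _ => hx, h.const]
  -- Sweep the square: the transport around the part below height `y` does not depend on `y`.
  · have hconst : IsLocallyConstant fun y =>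
        f (col S 0) y * f (row S y) 1 * (f (col S 1) y)⁻¹ := by
      rw [IsLocallyConstant.iff_eventually_eq]
      intro y
      filter_upwards [h.eventually_isPrimitive_row hopen hcov S (hf (row S y)), hf (col S 0) y,
        hf (col S 1) y] with y' hrow hleft hright
      have hrow' := congrFun ((hf (row S y')).ext
        (hrow.const_mul (φ ((col S 0).comp (seg y y')))⁻¹) (by simp [hf0])) 1
      rw [hrow', hleft, hright]
      group
    have h01 := hconst.apply_eq_of_preconnectedSpace 0 1
    simp only [hf0, one_mul, inv_one, mul_one] at h01
    rw [h01, inv_mul_cancel_right]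

variable {f : C(Y, X)} {g : C(Z, X)}

theorem ext_of_isOpenEmbedding (hf : IsOpenEmbedding f) (hg : IsOpenEmbedding g)
    (hfg : Set.range f ∪ Set.range g = Set.univ) {φ ψ : Transport X H}
    (hφψf : φ.comap f = ψ.comap f) (hφψg : φ.comap g = ψ.comap g) : φ = ψ := by
  refine ext_of_openCover (𝒲 := {Set.range f, Set.range g}) ?_ (by rwa [Set.sUnion_pair]) ?_
  · rintro W (rfl | rfl)
    exacts [hf.isOpen_range, hg.isOpen_range]
  · rintro c W (rfl | rfl) hc
    · obtain ⟨c, rfl⟩ := exists_comp_eq_of_isEmbedding hf.isEmbedding c hc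
      exact DFunLike.congr_fun hφψf c
    · obtain ⟨c, rfl⟩ := exists_comp_eq_of_isEmbedding hg.isEmbedding c hc
      exact DFunLike.congr_fun hφψg c

theorem exists_comap_eq_of_isOpenEmbedding (hf : IsOpenEmbedding f) (hg : IsOpenEmbedding g)
    (hfg : Set.range f ∪ Set.range g = Set.univ) {φ : Transport Y H} {ψ : Transport Z H}
    (hφψ : ∀ c c', f.comp c = g.comp c' → φ c = ψ c') :
    ∃ χ : Transport X H, χ.comap f = φ ∧ χ.comap g = ψ := by
  let χ : C(I, X) → H := Function.extend f.comp φ (Function.extend g.comp ψ 1)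
  have hχf (c : C(I, Y)) : χ (f.comp c) = φ c :=
    Function.Injective.extend_apply (fun _ _ => (ContinuousMap.cancel_left hf.injective).1) _ _ c
  have hχg (c : C(I, Z)) : χ (g.comp c) = ψ c := by
    by_cases h : ∃ c', f.comp c' = g.comp c
    · obtain ⟨c', hc'⟩ := h
      rw [← hc', hχf, hφψ c' c hc']
    · exact (Function.extend_apply' _ _ _ h).trans (Function.Injective.extend_apply
        (fun _ _ => (ContinuousMap.cancel_left hg.injective).1) _ _ c)
  have hχ : IsTransportOn {Set.range f, Set.range g} χ := by
    refine ⟨fun x => ?_, ?_⟩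
    · rcases hfg.symm.subset (Set.mem_univ x) with ⟨y, rfl⟩ | ⟨z, rfl⟩
      · exact (hχf (ContinuousMap.const I y)).trans (φ.apply_const y)
      · exact (hχg (ContinuousMap.const I z)).trans (ψ.apply_const z)
    · rintro S ⟨W, rfl | rfl, hS⟩
      · obtain ⟨S, rfl⟩ := exists_comp_eq_of_isEmbedding hf.isEmbedding S hS
        change χ (f.comp (row S 0)) * χ (f.comp (col S 1)) =
          χ (f.comp (col S 0)) * χ (f.comp (row S 1))
        simp only [hχf]
        exact φ.isTransportOn.square S ⟨_, rfl, fun _ => trivial⟩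
      · obtain ⟨S, rfl⟩ := exists_comp_eq_of_isEmbedding hg.isEmbedding S hS
        change χ (g.comp (row S 0)) * χ (g.comp (col S 1)) =
          χ (g.comp (col S 0)) * χ (g.comp (row S 1))
        simp only [hχg]
        exact ψ.isTransportOn.square S ⟨_, rfl, fun _ => trivial⟩
  obtain ⟨ω, hω⟩ := exists_extension hχ
    (by rintro W (rfl | rfl); exacts [hf.isOpen_range, hg.isOpen_range])
    (by rw [Set.sUnion_pair, hfg])
  refine ⟨ω, Transport.ext fun c => ?_, Transport.ext fun c => ?_⟩
  · exact (hω _ _ (Or.inl rfl) fun x => ⟨c x, rfl⟩).trans (hχf c)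
  · exact (hω _ _ (Or.inr rfl) fun x => ⟨c x, rfl⟩).trans (hχg c)

end Gluing

end Transport

section Glue

variable {X : Type*} [TopologicalSpace X] {U V A B : Set X} {a b : X}

theorem inU_injective : Function.Injective (inU U V B) := fun x y h => by
  rcases Quotient.exact h with h | h
  · exact Sum.inl_injective h
  · exact Subtype.ext h.1

theorem inV_injective : Function.Injective (inV U V B) := fun x y h => by
  rcases Quotient.exact h with h | h
  · exact Sum.inr_injective h
  · exact Subtype.ext h.1

theorem inU_eq_inV_iff {x : U} {y : V} :
    inU U V B x = inV U V B y ↔ (x : X) = y ∧ (x : X) ∈ B := by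
  refine ⟨fun h => ?_, fun h => Quotient.sound (Or.inr h)⟩
  rcases Quotient.exact h with h | h
  · exact (Sum.inl_ne_inr h).elim
  · exact h

theorem range_inU_union_range_inV : Set.range (inU U V B) ∪ Set.range (inV U V B) = Set.univ := by
  refine Set.eq_univ_of_forall fun z => ?_
  induction z using Quotient.inductionOn with | _ s =>
  rcases s with x | x
  · exact Or.inl ⟨x, rfl⟩
  · exact Or.inr ⟨x, rfl⟩

theorem isOpenEmbedding_inU (hBo : IsOpen B) (hBU : B ⊆ U) : IsOpenEmbedding (inU U V B) := by
  refine .of_continuous_injective_isOpenMap (inU U V B).continuous inU_injective ?_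
  rintro _ ⟨O, hO, rfl⟩
  refine isOpen_coinduced.2 (isOpen_sum_iff.2 ⟨?_, ?_⟩)
  · convert hO.preimage (continuous_subtype_val (p := (· ∈ U))) using 1
    ext x
    exact inU_injective.mem_set_image
  · convert (hBo.inter hO).preimage (continuous_subtype_val (p := (· ∈ V))) using 1
    ext y
    constructor
    · rintro ⟨x, hx, hxy⟩
      obtain ⟨hxy', hxB⟩ := inU_eq_inV_iff.1 hxy
      exact ⟨hxy' ▸ hxB, show (y : X) ∈ O from hxy' ▸ hx⟩
    · rintro ⟨hyB, hyO⟩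
      exact ⟨⟨y, hBU hyB⟩, hyO, inU_eq_inV _ _ hyB⟩

theorem isOpenEmbedding_inV (hBo : IsOpen B) (hBV : B ⊆ V) : IsOpenEmbedding (inV U V B) := by
  refine .of_continuous_injective_isOpenMap (inV U V B).continuous inV_injective ?_
  rintro _ ⟨O, hO, rfl⟩
  refine isOpen_coinduced.2 (isOpen_sum_iff.2 ⟨?_, ?_⟩)
  · convert (hBo.inter hO).preimage (continuous_subtype_val (p := (· ∈ U))) using 1
    ext x
    constructor
    · rintro ⟨y, hy, hyx⟩
      obtain ⟨hxy, hxB⟩ := inU_eq_inV_iff.1 hyx.symm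
      exact ⟨hxB, show (x : X) ∈ O from hxy ▸ hy⟩
    · rintro ⟨hxB, hxO⟩
      exact ⟨⟨x, hBV hxB⟩, hxO, (inU_eq_inV _ _ hxB).symm⟩
  · convert hO.preimage (continuous_subtype_val (p := (· ∈ V))) using 1
    ext y
    exact inV_injective.mem_set_image

theorem pathConnectedSpace_glue (hU : IsPathConnected U) (hV : IsPathConnected V)
    (hBUV : B ⊆ U ∩ V) (hB : B.Nonempty) : PathConnectedSpace (Glue U V B) := by
  obtain ⟨b, hb⟩ := hB
  have := isPathConnected_iff_pathConnectedSpace.1 hU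
  have := isPathConnected_iff_pathConnectedSpace.1 hV
  rw [pathConnectedSpace_iff_univ, ← range_inU_union_range_inV]
  exact (isPathConnected_range (inU U V B).continuous).union
    (isPathConnected_range (inV U V B).continuous)
    ⟨_, ⟨⟨b, (hBUV hb).1⟩, rfl⟩, ⟨⟨b, (hBUV hb).2⟩, (inU_eq_inV _ _ hb).symm⟩⟩

theorem sigma_surjective (hX : U ∪ V = Set.univ) : Function.Surjective (sigma U V B) := fun x => by
  rcases hX.symm.subset (Set.mem_univ x) with hx | hx
  · exact ⟨inU U V B ⟨x, hx⟩, rfl⟩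
  · exact ⟨inV U V B ⟨x, hx⟩, rfl⟩

/-- The homomorphism `σ_* : π₁(C, b) → π₁(X, b)`, where the base point of `C` is the image of
`b ∈ V`. -/
noncomputable def sigmaStar (hbV : b ∈ V) :
    PiOne (Glue U V B) (inV U V B ⟨b, hbV⟩) →* PiOne X b :=
  PiOne.map (sigma U V B) rfl

/-- The map `î : A → C` through the copy `U'` of `U`. -/
def viaU (hUV : U ∩ V = A ∪ B) : C(A, Glue U V B) :=
  (inU U V B).comp (ContinuousMap.inclusion (left_subset_U hUV))

/-- The map `i : A → C` through `V`. -/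
def viaV (hUV : U ∩ V = A ∪ B) : C(A, Glue U V B) :=
  (inV U V B).comp (ContinuousMap.inclusion (left_subset_V hUV))

theorem viaU_injective (hUV : U ∩ V = A ∪ B) : Function.Injective (viaU hUV) :=
  inU_injective.comp (Set.inclusion_injective (left_subset_U hUV))

theorem viaU_ne_inV (hUV : U ∩ V = A ∪ B) (hAB : Disjoint A B) (x : A) (y : V) :
    viaU hUV x ≠ inV U V B y := fun h =>
  Set.disjoint_left.1 hAB x.2 (inU_eq_inV_iff.1 h).2

theorem inU_eq_inV_or_exists_eq_via (hUV : U ∩ V = A ∪ B) {x : U} {y : V} (h : (x : X) = y) :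
    inU U V B x = inV U V B y ∨ ∃ z, inU U V B x = viaU hUV z ∧ inV U V B y = viaV hUV z := by
  rcases hUV.subset ⟨x.2, h ▸ y.2⟩ with hx | hx
  · exact Or.inr ⟨⟨x, hx⟩, rfl, congrArg _ (Subtype.ext h.symm)⟩
  · exact Or.inl (inU_eq_inV_iff.2 ⟨h, hx⟩)

theorem eq_of_sigma_eq_sigma {α : Type*} (hUV : U ∩ V = A ∪ B) {v : Glue U V B → α}
    (hv : v ∘ viaU hUV = v ∘ viaV hUV) {z z' : Glue U V B}
    (h : sigma U V B z = sigma U V B z') : v z = v z' := by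
  have hmixed {x : U} {y : V} (hxy : (x : X) = y) : v (inU U V B x) = v (inV U V B y) := by
    rcases inU_eq_inV_or_exists_eq_via hUV hxy with h | ⟨z, hx, hy⟩
    · exact congrArg v h
    · rw [hx, hy]
      exact congrFun hv z
  rcases range_inU_union_range_inV.symm.subset (Set.mem_univ z) with ⟨x, rfl⟩ | ⟨x, rfl⟩ <;>
    rcases range_inU_union_range_inV.symm.subset (Set.mem_univ z') with ⟨y, rfl⟩ | ⟨y, rfl⟩
  · exact congrArg (fun x => v (inU U V B x)) (Subtype.ext h)
  · exact hmixed h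
  · exact (hmixed h.symm).symm
  · exact congrArg (fun x => v (inV U V B x)) (Subtype.ext h)

theorem forall_mem_pathComponentIn {W : Set X} {c : C(I, X)} (hc : ∀ s, c s ∈ W) {s : I}
    (hs : c s ∈ pathComponentIn W a) (t : I) : c t ∈ pathComponentIn W a := by
  have hst : JoinedIn W (c s) (c t) :=
    ⟨⟨c.comp (seg s t), congrArg c (seg_zero s t), congrArg c (seg_one s t)⟩, fun _ => hc _⟩
  exact JoinedIn.trans hs hst

theorem pathConnectedSpace_of_eq_pathComponentIn {W : Set X} (hA : A = pathComponentIn W a)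
    (ha : a ∈ A) : PathConnectedSpace A := by
  subst hA
  exact isPathConnected_iff_pathConnectedSpace.1
    (isPathConnected_pathComponentIn (pathComponentIn_subset ha))

theorem forall_mem_left_or_forall_mem_right (hUV : U ∩ V = A ∪ B)
    (hA : A = pathComponentIn (U ∩ V) a) {c : C(I, X)} (hc : ∀ s, c s ∈ U ∩ V) :
    (∀ s, c s ∈ A) ∨ ∀ s, c s ∈ B := by
  by_cases h : ∃ s, c s ∈ A
  · obtain ⟨s, hs⟩ := h
    rw [hA] at hs ⊢
    exact Or.inl (forall_mem_pathComponentIn hc hs)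
  · exact Or.inr fun s => (hUV.subset (hc s)).resolve_left fun hs => h ⟨s, hs⟩

end Glue

section Descent

variable {X : Type*} [TopologicalSpace X] {U V A B : Set X} {a : X} {H : Type*} [Group H]

namespace Transport

theorem comap_sigma_injective (hU : IsOpen U) (hV : IsOpen V) (hX : U ∪ V = Set.univ) :
    Function.Injective (comap (H := H) (sigma U V B)) := fun φ ψ h => by
  refine ext_of_isOpenEmbedding (f := ⟨((↑) : U → X), continuous_subtype_val⟩)
    (g := ⟨((↑) : V → X), continuous_subtype_val⟩) hU.isOpenEmbedding_subtypeVal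
    hV.isOpenEmbedding_subtypeVal (by simpa using hX) ?_ ?_
  exacts [congrArg (comap (inU U V B)) h, congrArg (comap (inV U V B)) h]

theorem exists_comap_sigma_eq (hU : IsOpen U) (hV : IsOpen V) (hX : U ∪ V = Set.univ)
    (hUV : U ∩ V = A ∪ B) (hA : A = pathComponentIn (U ∩ V) a) (hBo : IsOpen B)
    {ψ : Transport (Glue U V B) H} (hψ : ψ.comap (viaU hUV) = ψ.comap (viaV hUV)) :
    ∃ φ : Transport X H, φ.comap (sigma U V B) = ψ := by
  obtain ⟨φ, hφU, hφV⟩ := exists_comap_eq_of_isOpenEmbedding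
    (f := ⟨((↑) : U → X), continuous_subtype_val⟩) (g := ⟨((↑) : V → X), continuous_subtype_val⟩)
    (φ := ψ.comap (inU U V B)) (ψ := ψ.comap (inV U V B)) hU.isOpenEmbedding_subtypeVal
    hV.isOpenEmbedding_subtypeVal (by simpa using hX) fun c c' hcc' => by
      have hval (s : I) : (c s : X) = c' s := DFunLike.congr_fun hcc' s
      rcases forall_mem_left_or_forall_mem_right hUV hA
        (c := (⟨((↑) : U → X), continuous_subtype_val⟩ : C(U, X)).comp c)
        (fun s => ⟨(c s).2, (congrArg (· ∈ V) (hval s)).mpr (c' s).2⟩) with hc | hc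
      · have hcA := DFunLike.congr_fun hψ (⟨fun s => ⟨c s, hc s⟩, by fun_prop⟩ : C(I, A))
        exact hcA.trans (congrArg ψ (ContinuousMap.ext fun s =>
          congrArg (inV U V B) (Subtype.ext (hval s))))
      · exact congrArg ψ (ContinuousMap.ext fun s => inU_eq_inV_iff.2 ⟨hval s, hc s⟩)
  exact ⟨φ, ext_of_isOpenEmbedding (isOpenEmbedding_inU hBo (right_subset_U hUV))
    (isOpenEmbedding_inV hBo (right_subset_V hUV)) range_inU_union_range_inV hφU hφV⟩

theorem exists_eq_gauge_of_comap_sigma_eq_gauge (hU : IsOpen U) (hV : IsOpen V)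
    (hX : U ∪ V = Set.univ) (hUV : U ∩ V = A ∪ B) {φ ψ : Transport X H} {v : Glue U V B → H}
    (hv : v ∘ viaU hUV = v ∘ viaV hUV)
    (h : φ.comap (sigma U V B) = (ψ.comap (sigma U V B)).gauge v) :
    ∃ w : X → H, w ∘ sigma U V B = v ∧ φ = ψ.gauge w := by
  have hw : Function.extend (sigma U V B) v 1 ∘ sigma U V B = v := funext fun z =>
    Function.FactorsThrough.extend_apply (fun _ _ => eq_of_sigma_eq_sigma hUV hv) 1 z
  exact ⟨_, hw, comap_sigma_injective (B := B) hU hV hX (by rw [h, comap_gauge, hw])⟩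

end Transport

end Descent

section VanKampen

variable {X : Type*} [TopologicalSpace X] {U V A B : Set X} {a b : X} {H : Type*} [Group H]
  (hUV : U ∩ V = A ∪ B) (ha : a ∈ A) (hb : b ∈ B)
  (p : Path (⟨b, right_subset_U hUV hb⟩ : U) ⟨a, left_subset_U hUV ha⟩)
  (q : Path (⟨b, right_subset_V hUV hb⟩ : V) ⟨a, left_subset_V hUV ha⟩)

namespace Transport

theorem hol_theta (ψ : Transport (Glue U V B) H) (α : PiOne A ⟨a, ha⟩) :
    ψ.hol _ (theta hUV ha hb q α) = ψ.comap (inV U V B) q.toContinuousMap *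
      (ψ.comap (viaV hUV)).hol ⟨a, ha⟩ α * (ψ.comap (inV U V B) q.toContinuousMap)⁻¹ :=
  (ψ.hol_changeBase _ _).trans
    (congrArg (fun g => _ * g * _) (ψ.hol_piOneMap (viaV hUV) rfl α))

theorem hol_thetaHat (ψ : Transport (Glue U V B) H) (α : PiOne A ⟨a, ha⟩) :
    ψ.hol _ (thetaHat hUV ha hb p α) = ψ.comap (inU U V B) p.toContinuousMap *
      (ψ.comap (viaU hUV)).hol ⟨a, ha⟩ α * (ψ.comap (inU U V B) p.toContinuousMap)⁻¹ :=
  (ψ.hol_changeBase _ _).trans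
    (congrArg (fun g => _ * g * _) (ψ.hol_piOneMap (viaU hUV) rfl α))

theorem hol_sigmaStar (φ : Transport X H) (hbV : b ∈ V)
    (γ : PiOne (Glue U V B) (inV U V B ⟨b, hbV⟩)) :
    φ.hol b (sigmaStar hbV γ) = (φ.comap (sigma U V B)).hol _ γ :=
  φ.hol_piOneMap _ _ _

theorem hol_tau (φ : Transport X H) :
    φ.hol b (tau hUV ha hb p q) = (φ.comap (sigma U V B)).comap (inU U V B) p.toContinuousMap *
      ((φ.comap (sigma U V B)).comap (inV U V B) q.toContinuousMap)⁻¹ :=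
  (φ.apply_trans _ _).trans (congrArg (_ * ·) (φ.apply_symm _))

end Transport

theorem sigmaStar_thetaHat [PathConnectedSpace X] (α : PiOne A ⟨a, ha⟩) :
    sigmaStar _ (thetaHat hUV ha hb p α) =
      tau hUV ha hb p q * sigmaStar _ (theta hUV ha hb q α) * (tau hUV ha hb p q)⁻¹ := by
  obtain ⟨φ, hφ⟩ := Transport.exists_hol_eq (MonoidHom.id (PiOne X b))
  suffices φ.hol b (sigmaStar _ (thetaHat hUV ha hb p α)) =
      φ.hol b (tau hUV ha hb p q * sigmaStar _ (theta hUV ha hb q α) *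
        (tau hUV ha hb p q)⁻¹) by rwa [hφ] at this
  have hA : (φ.comap (sigma U V B)).comap (viaU hUV) = (φ.comap (sigma U V B)).comap (viaV hUV) :=
    rfl
  rw [map_mul, map_mul, map_inv, Transport.hol_sigmaStar, Transport.hol_sigmaStar,
    Transport.hol_thetaHat, Transport.hol_theta, Transport.hol_tau, hA]
  group

theorem exists_transport_glue [PathConnectedSpace (Glue U V B)] [PathConnectedSpace A]
    (hAB : Disjoint A B)
    (f : PiOne (Glue U V B) (inV U V B ⟨b, right_subset_V hUV hb⟩) →* H) {T : H}
    (hf : ∀ α, f (thetaHat hUV ha hb p α) = T * f (theta hUV ha hb q α) * T⁻¹) :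
    ∃ ψ : Transport (Glue U V B) H, ψ.hol _ = f ∧
      ψ.comap (inU U V B) p.toContinuousMap * (ψ.comap (inV U V B) q.toContinuousMap)⁻¹ = T ∧
      ψ.comap (viaU hUV) = ψ.comap (viaV hUV) := by
  obtain ⟨ψ, rfl⟩ := Transport.exists_hol_eq f
  set P : H := ψ.comap (inU U V B) p.toContinuousMap with hP
  set Q : H := ψ.comap (inV U V B) q.toContinuousMap with hQ
  have hconj (α) : (ψ.comap (viaV hUV)).hol ⟨a, ha⟩ α =
      (P⁻¹ * T * Q)⁻¹ * (ψ.comap (viaU hUV)).hol ⟨a, ha⟩ α * (P⁻¹ * T * Q) := by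
    have hα := hf α
    rw [Transport.hol_thetaHat, Transport.hol_theta, ← hP, ← hQ, mul_inv_eq_iff_eq_mul,
      ← eq_inv_mul_iff_mul_eq] at hα
    rw [hα]
    group
  obtain ⟨g, hga, hg⟩ := Transport.exists_eq_gauge hconj
  -- Correct `ψ` by `g` on the copy of `A` in `U'` and leave it unchanged elsewhere.
  let u : Glue U V B → H := Function.extend (viaU hUV) g 1
  have huU : u ∘ viaU hUV = g := funext ((viaU_injective hUV).extend_apply g 1)
  have huV (y : V) : u (inV U V B y) = 1 :=
    Function.extend_apply' _ _ _ fun ⟨x, hx⟩ => viaU_ne_inV hUV hAB x y hx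
  have huA : u (inU U V B ⟨a, left_subset_U hUV ha⟩) = P⁻¹ * T * Q :=
    (congrFun huU ⟨a, ha⟩).trans hga
  have hub : u (inU U V B ⟨b, right_subset_U hUV hb⟩) = 1 := by
    rw [inU_eq_inV _ (right_subset_V hUV hb) hb, huV]
  refine ⟨ψ.gauge u, ψ.hol_gauge_of_eq_one (huV _), ?_, ?_⟩
  · rw [Transport.comap_gauge, Transport.comap_gauge, Transport.gauge_apply, Transport.gauge_apply]
    simp only [Path.coe_toContinuousMap, Path.source, Path.target, Function.comp_apply, huA, hub,
      huV, ← hP, ← hQ]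
    group
  · rw [Transport.comap_gauge, huU, ← hg, Transport.comap_gauge,
      show u ∘ viaV hUV = 1 from funext fun x => huV _, Transport.gauge_one]

theorem exists_piOneHom (hU : IsOpen U) (hV : IsOpen V) (hX : U ∪ V = Set.univ)
    [PathConnectedSpace (Glue U V B)] (hAB : Disjoint A B) (hA : A = pathComponentIn (U ∩ V) a)
    (hBo : IsOpen B) (f : PiOne (Glue U V B) (inV U V B ⟨b, right_subset_V hUV hb⟩) →* H) {T : H}
    (hf : ∀ α, f (thetaHat hUV ha hb p α) = T * f (theta hUV ha hb q α) * T⁻¹) :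
    ∃ g : PiOne X b →* H, (∀ γ, g (sigmaStar _ γ) = f γ) ∧
      g (tau hUV ha hb p q) = T := by
  have := pathConnectedSpace_of_eq_pathComponentIn hA ha
  obtain ⟨ψ, rfl, hT, hψ⟩ := exists_transport_glue hUV ha hb p q hAB f hf
  obtain ⟨φ, rfl⟩ := Transport.exists_comap_sigma_eq hU hV hX hUV hA hBo hψ
  exact ⟨φ.hol b, φ.hol_sigmaStar _, (φ.hol_tau hUV ha hb p q).trans hT⟩

theorem piOneHom_ext (hU : IsOpen U) (hV : IsOpen V) (hX : U ∪ V = Set.univ)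
    [PathConnectedSpace (Glue U V B)] [PathConnectedSpace A] {f g : PiOne X b →* H}
    (hσ : ∀ γ : PiOne (Glue U V B) (inV U V B ⟨b, right_subset_V hUV hb⟩),
      f (sigmaStar _ γ) = g (sigmaStar _ γ))
    (hτ : f (tau hUV ha hb p q) = g (tau hUV ha hb p q)) : f = g := by
  have : PathConnectedSpace X := (sigma_surjective hX).pathConnectedSpace (sigma U V B).continuous
  obtain ⟨φ, rfl⟩ := Transport.exists_hol_eq f
  obtain ⟨ψ, rfl⟩ := Transport.exists_hol_eq g
  obtain ⟨v, hvb, hv⟩ := Transport.exists_eq_gauge (φ := φ.comap (sigma U V B))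
    (ψ := ψ.comap (sigma U V B)) (x := inV U V B ⟨b, right_subset_V hUV hb⟩) (h := 1) fun γ => by
      have hγ := hσ γ
      rw [Transport.hol_sigmaStar, Transport.hol_sigmaStar] at hγ
      rw [inv_one, one_mul, mul_one, hγ]
  have hva : (v ∘ viaU hUV) ⟨a, ha⟩ = (v ∘ viaV hUV) ⟨a, ha⟩ := by
    have hvb' : v (inU U V B ⟨b, right_subset_U hUV hb⟩) = 1 := by
      rw [inU_eq_inV _ (right_subset_V hUV hb) hb, hvb]
    rw [Transport.hol_tau, Transport.hol_tau, hv] at hτ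
    simp only [Transport.comap_gauge, Transport.gauge_apply, Path.coe_toContinuousMap, Path.source,
      Path.target, Function.comp_apply, hvb, hvb', inv_one, one_mul] at hτ
    rw [mul_inv_rev, mul_assoc, mul_right_inj, ← mul_assoc, mul_eq_right, mul_inv_eq_one] at hτ
    exact hτ
  have hvUV : v ∘ viaU hUV = v ∘ viaV hUV := by
    refine Transport.eq_of_gauge_eq_gauge (ψ := (ψ.comap (sigma U V B)).comap (viaU hUV)) ?_ hva
    rw [← Transport.comap_gauge, ← hv]
    exact congrArg (Transport.comap (viaV hUV)) hv
  obtain ⟨w, hw, rfl⟩ := Transport.exists_eq_gauge_of_comap_sigma_eq_gauge hU hV hX hUV hvUV hv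
  exact ψ.hol_gauge_of_eq_one ((congrFun hw _).trans hvb)

end VanKampen

namespace FreeProductWithRelation

variable {K H G : Type*} [Group K] [Group H] [Group G] (θ θhat : K →* H)

/-- The canonical homomorphism from the first factor of the free product. -/
def of : H →* FreeProductWithRelation θ θhat := (QuotientGroup.mk' _).comp Monoid.Coprod.inl

/-- The image of the generator `t`. -/
def stableLetter : FreeProductWithRelation θ θhat := QuotientGroup.mk (Monoid.Coprod.inr t)

theorem of_eq_conj (α : K) : of θ θhat (θhat α) =
    stableLetter θ θhat * of θ θhat (θ α) * (stableLetter θ θhat)⁻¹ := by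
  rw [← mul_inv_eq_one]
  exact (QuotientGroup.eq_one_iff _).2 (Subgroup.subset_normalClosure ⟨α, rfl⟩)

variable {θ θhat}

/-- The homomorphism given by the universal property: it restricts to `f` and maps `t` to `T`. -/
def lift (f : H →* G) (T : G) (hf : ∀ α, f (θhat α) = T * f (θ α) * T⁻¹) :
    FreeProductWithRelation θ θhat →* G :=
  QuotientGroup.lift _ (Monoid.Coprod.lift f (FreeGroup.lift fun _ => T)) (by
    refine Subgroup.normalClosure_le_normal ?_
    rintro _ ⟨α, rfl⟩
    refine MonoidHom.mem_ker.2 ?_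
    simp only [map_mul, map_inv, Monoid.Coprod.lift_apply_inl, Monoid.Coprod.lift_apply_inr, t,
      FreeGroup.lift_apply_of, hf, mul_inv_cancel])

section Lift

variable {f : H →* G} {T : G} (hf : ∀ α, f (θhat α) = T * f (θ α) * T⁻¹)

theorem lift_of (γ : H) : lift f T hf (of θ θhat γ) = f γ :=
  (QuotientGroup.lift_mk' _ _ _).trans (Monoid.Coprod.lift_apply_inl _ _ γ)

theorem lift_stableLetter : lift f T hf (stableLetter θ θhat) = T :=
  (QuotientGroup.lift_mk' _ _ _).trans
    ((Monoid.Coprod.lift_apply_inr _ _ t).trans FreeGroup.lift_apply_of)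

end Lift

theorem hom_ext {f g : FreeProductWithRelation θ θhat →* G}
    (hof : ∀ γ, f (of θ θhat γ) = g (of θ θhat γ))
    (ht : f (stableLetter θ θhat) = g (stableLetter θ θhat)) : f = g :=
  QuotientGroup.monoidHom_ext _ <| Monoid.Coprod.hom_ext (MonoidHom.ext hof) <|
    FreeGroup.ext_hom _ _ fun _ => ht

end FreeProductWithRelation

end VanKampen

open VanKampen in
theorem mainTheorem4_general {X : Type*} [TopologicalSpace X] {U V A B : Set X} {a b : X}
    (hU : IsOpen U) (hV : IsOpen V) (hX : U ∪ V = Set.univ) [PathConnectedSpace (Glue U V B)]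
    (hUV : U ∩ V = A ∪ B) (hAB : Disjoint A B) (ha : a ∈ A) (hb : b ∈ B)
    (hA : A = pathComponentIn (U ∩ V) a) (hBo : IsOpen B)
    (p : Path (⟨b, right_subset_U hUV hb⟩ : U) ⟨a, left_subset_U hUV ha⟩)
    (q : Path (⟨b, right_subset_V hUV hb⟩ : V) ⟨a, left_subset_V hUV ha⟩) :
    ∃ e : FreeProductWithRelation (theta hUV ha hb q) (thetaHat hUV ha hb p) ≃* PiOne X b,
      (∀ γ : PiOne (Glue U V B) (inV U V B ⟨b, right_subset_V hUV hb⟩),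
        e (QuotientGroup.mk (Monoid.Coprod.inl γ)) = PiOne.map (sigma U V B) rfl γ) ∧
      e (QuotientGroup.mk (Monoid.Coprod.inr t)) = tau hUV ha hb p q := by
  have := (sigma_surjective (B := B) hX).pathConnectedSpace (sigma U V B).continuous
  have := pathConnectedSpace_of_eq_pathComponentIn hA ha
  let toPiOne := FreeProductWithRelation.lift (sigmaStar (right_subset_V hUV hb))
    (tau hUV ha hb p q) (sigmaStar_thetaHat hUV ha hb p q)
  have toPiOne_of (γ) : toPiOne (FreeProductWithRelation.of _ _ γ) = sigmaStar _ γ :=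
    FreeProductWithRelation.lift_of _ γ
  have toPiOne_stableLetter :
      toPiOne (FreeProductWithRelation.stableLetter _ _) = tau hUV ha hb p q :=
    FreeProductWithRelation.lift_stableLetter _
  obtain ⟨ofPiOne, ofPiOne_sigmaStar, ofPiOne_tau⟩ :=
    exists_piOneHom hUV ha hb p q hU hV hX hAB hA hBo _ (FreeProductWithRelation.of_eq_conj _ _)
  have leftInverse : ofPiOne.comp toPiOne = MonoidHom.id _ := FreeProductWithRelation.hom_ext
    (fun γ => (congrArg ofPiOne (toPiOne_of γ)).trans (ofPiOne_sigmaStar γ))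
    ((congrArg ofPiOne toPiOne_stableLetter).trans ofPiOne_tau)
  have rightInverse : toPiOne.comp ofPiOne = MonoidHom.id _ := piOneHom_ext hUV ha hb p q hU hV hX
    (fun γ => (congrArg toPiOne (ofPiOne_sigmaStar γ)).trans (toPiOne_of γ))
    ((congrArg toPiOne ofPiOne_tau).trans toPiOne_stableLetter)
  exact ⟨toPiOne.toMulEquiv ofPiOne leftInverse rightInverse, toPiOne_of, toPiOne_stableLetter⟩

theorem mainTheorem4 {X : Type*} [TopologicalSpace X] {U V A B : Set X} {a b : X}
    (hU : IsOpen U) (hV : IsOpen V) (hX : U ∪ V = Set.univ)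
    (hUc : IsPathConnected U) (hVc : IsPathConnected V)
    (hUV : U ∩ V = A ∪ B) (hAB : Disjoint A B) (ha : a ∈ A) (hb : b ∈ B)
    (hA : A = pathComponentIn (U ∩ V) a) (hB : B = pathComponentIn (U ∩ V) b)
    (hBo : IsOpen B)
    (p : Path (⟨b, VanKampen.right_subset_U hUV hb⟩ : U) ⟨a, VanKampen.left_subset_U hUV ha⟩)
    (q : Path (⟨b, VanKampen.right_subset_V hUV hb⟩ : V) ⟨a, VanKampen.left_subset_V hUV ha⟩) :
    ∃ e : VanKampen.FreeProductWithRelation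
          (VanKampen.theta hUV ha hb q) (VanKampen.thetaHat hUV ha hb p) ≃*
        VanKampen.PiOne X b,
      (∀ γ : VanKampen.PiOne (VanKampen.Glue U V B)
          (VanKampen.inV U V B ⟨b, VanKampen.right_subset_V hUV hb⟩),
        e (QuotientGroup.mk (Monoid.Coprod.inl γ)) =
          VanKampen.PiOne.map (VanKampen.sigma U V B) rfl γ) ∧
      e (QuotientGroup.mk (Monoid.Coprod.inr VanKampen.t)) = VanKampen.tau hUV ha hb p q := by
  have := VanKampen.pathConnectedSpace_glue hUc hVc
    (hUV.symm ▸ Set.subset_union_right) ⟨b, hb⟩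
  exact mainTheorem4_general hU hV hX hUV hAB ha hb hA hBo p q
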